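/- Let $k=\mathbb{R}$ or $k=\mathbb{C}$ and let $n\ge 2$. For $d\ge 1$ let $W_d(k)$ be the projective space of nonzero $(n+1)$-tuples $(h_0,\dots,h_n)$ of homogeneous polynomials of degree $d$ in $k[x_0,\dots,x_n]$ modulo common scaling by $k^*$, with its classical Euclidean topology. Let $H_d(k)\subseteq W_d(k)$ be the subspace of those $h=[h_0:\dots:h_n]$ for which the rational map $\psi_h\colon[x_0:\dots:x_n]\dashrightarrow[h_0(x):\dots:h_n(x)]$ of $\mathbb{P}^n_k$ is birational, and let $\pi_d\colon H_d(k)\to \mathrm{Bir}(\mathbb{P}^n_k)$ be the map $h\mapsto\psi_h$. Its image is the set $\mathrm{Bir}(\mathbb{P}^n_k)_{\le d}$ of birational maps of degree at most $d$, which is given the quotient topology with respect to $\pi_d$. The Euclidean topology on $\mathrm{Bir}(\mathbb{P}^n_k)$ is the inductive limit topology of the $\mathrm{Bir}(\mathbb{P}^n_k)_{\le d}$, $d\ge1$. For $t\in[-1,1]$ let $\rho(t)$ be the rational map of $\mathbb{P}^n_k$ with $\rho(0)=\mathrm{id}$ and, for $t\ne0$, $$\rho(t)\colon[x_0:\dots:x_n]\dashrightarrow[x_0P^t:x_1P^t:x_2P^t+t\,x_0x_1:x_3P^t:\dots:x_nP^t],\qquad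 P^t=\cos\Big(\frac{2\pi}{t}\Big)x_0+x_1 .$$ Then every $\rho(t)$ is birational, the map $\rho\colon[-1,1]\to\mathrm{Bir}(\mathbb{P}^n_k)$ is continuous for the Euclidean topologies, and for every $0<\varepsilon\le1$ and every $d\ge1$ there is no continuous map $\rho_\varepsilon\colon(-\varepsilon,\varepsilon)\to H_d(k)$ with $\rho|_{(-\varepsilon,\varepsilon)}=\pi_d\circ\rho_\varepsilon$. -/

import Mathlib

noncomputable section

open MvPolynomial

namespace Cremona

/-- `(n+1)`-tuples of homogeneous polynomials of degree `d` in `x_0, …, x_n` over `k`. -/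
abbrev HomTuple (k : Type*) [Field k] (n d : ℕ) : Type _ :=
  Fin (n + 1) → homogeneousSubmodule (Fin (n + 1)) k d

namespace HomTuple

variable {k : Type*} [Field k] {n d e : ℕ}

/-- Substitution: `F ∘ G = (F_0(G_0, …, G_n), …, F_n(G_0, …, G_n))`. -/
def comp (F : HomTuple k n d) (G : HomTuple k n e) : HomTuple k n (e * d) := fun i =>
  ⟨bind₁ (fun j => (G j : MvPolynomial (Fin (n + 1)) k)) (F i : MvPolynomial (Fin (n + 1)) k),
    ((mem_homogeneousSubmodule _ _).1 (F i).2).aeval _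
      fun j => (mem_homogeneousSubmodule _ _).1 (G j).2⟩

/-- The tuple `(x_0, …, x_n)`. -/
def coords (k : Type*) [Field k] (n : ℕ) : HomTuple k n 1 := fun i =>
  ⟨X i, (mem_homogeneousSubmodule _ _).2 (isHomogeneous_X k i)⟩

theorem coords_ne_zero (k : Type*) [Field k] (n : ℕ) : coords k n ≠ 0 := fun h =>
  X_ne_zero (R := k) (0 : Fin (n + 1)) (congrArg Subtype.val (congrFun h 0))

end HomTuple

/-- A formula for a rational self-map of `ℙ^n`: a nonzero tuple of homogeneous polynomials of
some common degree. -/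
abbrev Formula (k : Type*) [Field k] (n : ℕ) : Type _ :=
  Σ d : ℕ, {F : HomTuple k n d // F ≠ 0}

/-- Two formulas define the same rational map if and only if all the `2 × 2` minors
`F_i G_j - F_j G_i` vanish. -/
def formulaSetoid (k : Type*) [Field k] (n : ℕ) : Setoid (Formula k n) where
  r F G := ∀ i j, (F.2.1 i : MvPolynomial (Fin (n + 1)) k) * G.2.1 j = F.2.1 j * G.2.1 i
  iseqv :=
    { refl := fun F i j => mul_comm _ _
      symm := fun {F G} h i j => by
        rw [mul_comm, mul_comm (G.2.1 j : MvPolynomial (Fin (n + 1)) k)]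
        exact h j i
      trans := fun {F G H} h₁ h₂ i j => by
        obtain ⟨l, hl⟩ : ∃ l, (G.2.1 l : MvPolynomial (Fin (n + 1)) k) ≠ 0 := by
          by_contra hc
          push Not at hc
          exact G.2.2 (funext fun l => Subtype.ext (hc l))
        refine mul_left_cancel₀ (mul_ne_zero hl hl) ?_
        linear_combination
          (G.2.1 l * H.2.1 j : MvPolynomial (Fin (n + 1)) k) * h₁ i l
          + (G.2.1 l * F.2.1 l : MvPolynomial (Fin (n + 1)) k) * h₂ i j
          - (G.2.1 l * H.2.1 i : MvPolynomial (Fin (n + 1)) k) * h₁ j l }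

/-- Rational self-maps `ℙ^n ⇢ ℙ^n` over `k`. -/
def RatMap (k : Type*) [Field k] (n : ℕ) : Type _ := Quotient (formulaSetoid k n)

namespace RatMap

variable {k : Type*} [Field k] {n : ℕ}

/-- The rational map `[x_0 : … : x_n] ⇢ [F_0(x) : … : F_n(x)]`. -/
def of {d : ℕ} (F : HomTuple k n d) (hF : F ≠ 0) : RatMap k n :=
  Quotient.mk (formulaSetoid k n) ⟨d, F, hF⟩

/-- The identity of `ℙ^n`. -/
def id (k : Type*) [Field k] (n : ℕ) : RatMap k n :=
  of (HomTuple.coords k n) (HomTuple.coords_ne_zero k n)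

/-- The composition `f ∘ g` is defined and equal to `h`: for some formulas `F` of `f` and `G` of
`g`, the tuple `F ∘ G` is nonzero and is a formula of `h`. -/
def IsComp (f g h : RatMap k n) : Prop :=
  ∃ (d e : ℕ) (F : HomTuple k n d) (G : HomTuple k n e) (hF : F ≠ 0) (hG : G ≠ 0)
    (hFG : F.comp G ≠ 0), of F hF = f ∧ of G hG = g ∧ of (F.comp G) hFG = h

/-- `f` has a two-sided rational inverse. -/
def IsBirational (f : RatMap k n) : Prop :=
  ∃ g : RatMap k n, IsComp f g (id k n) ∧ IsComp g f (id k n)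

/-- The degree of a rational map: the least degree of a formula for it (equivalently, the degree of
a formula without common factor). -/
def degree (f : RatMap k n) : ℕ :=
  sInf {d | ∃ (F : HomTuple k n d) (hF : F ≠ 0), of F hF = f}

end RatMap

/-- The set `Bir(ℙ^n_k)` of birational self-maps of `ℙ^n` over `k`. -/
def Bir (k : Type*) [Field k] (n : ℕ) : Type _ := {f : RatMap k n // f.IsBirational}

/-- The set `Bir(ℙ^n_k)_{≤ d}` of birational maps of degree at most `d`. -/
def BirLE (k : Type*) [Field k] (n d : ℕ) : Type _ := {f : Bir k n // f.1.degree ≤ d}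

/-- The inclusion `Bir(ℙ^n_k)_{≤ d} → Bir(ℙ^n_k)`. -/
def BirLE.incl {k : Type*} [Field k] {n d : ℕ} (f : BirLE k n d) : Bir k n := f.1

/-- `W_d(k)`: the projective space of nonzero tuples of homogeneous polynomials of degree `d`, up
to a common nonzero scalar. -/
def W (k : Type*) [Field k] (n d : ℕ) : Type _ := Projectivization k (HomTuple k n d)

/-- The rational map `ψ_h` defined by a point `h` of `W_d(k)`. -/
def W.toRatMap {k : Type*} [Field k] {n d : ℕ} (h : W k n d) : RatMap k n :=
  Projectivization.lift (fun F : {F : HomTuple k n d // F ≠ 0} => RatMap.of F.1 F.2)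
    (fun F G t hFG => Quotient.sound (s := formulaSetoid k n) fun i j => by
      simp only [hFG, Pi.smul_apply, Submodule.coe_smul, smul_eq_C_mul]
      ring) h

/-- `H_d(k)`: the points of `W_d(k)` that define a birational map. -/
def H (k : Type*) [Field k] (n d : ℕ) : Type _ := {h : W k n d // h.toRatMap.IsBirational}

/-- The map `π_d : H_d(k) → Bir(ℙ^n_k)`, `h ↦ ψ_h`. -/
def piMap {k : Type*} [Field k] {n d : ℕ} (h : H k n d) : Bir k n := ⟨h.1.toRatMap, h.2⟩

theorem degree_piMap_le {k : Type*} [Field k] {n d : ℕ} (h : H k n d) :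
    (piMap h).1.degree ≤ d :=
  Nat.sInf_le ⟨h.1.rep, h.1.rep_nonzero, by
    conv_rhs => rw [show (piMap h).1 = W.toRatMap h.1 from rfl,
      ← Projectivization.mk_rep (h.1 : Projectivization k (HomTuple k n d))]
    rfl⟩

/-- The map `π_d : H_d(k) → Bir(ℙ^n_k)_{≤ d}`. -/
def piMapLE {k : Type*} [Field k] {n d : ℕ} (h : H k n d) : BirLE k n d :=
  ⟨piMap h, degree_piMap_le h⟩

section Topology

variable (k : Type*) [Field k] [TopologicalSpace k] (n d : ℕ)

/-- The Euclidean topology on the finite-dimensional space of homogeneous polynomials of degree `d`: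
the topology of the coefficients. -/
instance instTopologicalSpaceHomogeneous :
    TopologicalSpace (homogeneousSubmodule (Fin (n + 1)) k d) :=
  TopologicalSpace.induced
    (fun p (m : Fin (n + 1) →₀ ℕ) => coeff m (p : MvPolynomial (Fin (n + 1)) k))
    (inferInstance : TopologicalSpace ((Fin (n + 1) →₀ ℕ) → k))

/-- The Euclidean topology on the projective space `W_d(k)`: the quotient topology from the space
of nonzero tuples. -/
instance instTopologicalSpaceW : TopologicalSpace (W k n d) :=
  TopologicalSpace.coinduced
    (fun F : {F : HomTuple k n d // F ≠ 0} => (Projectivization.mk k F.1 F.2 : W k n d))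
    (inferInstance : TopologicalSpace {F : HomTuple k n d // F ≠ 0})

/-- The topology on `H_d(k)` as a subset of `W_d(k)`. -/
instance instTopologicalSpaceH : TopologicalSpace (H k n d) :=
  TopologicalSpace.induced (fun h => (h.1 : W k n d)) (instTopologicalSpaceW k n d)

/-- The quotient topology on `Bir(ℙ^n_k)_{≤ d}` with respect to `π_d`. -/
instance instTopologicalSpaceBirLE : TopologicalSpace (BirLE k n d) :=
  TopologicalSpace.coinduced piMapLE (instTopologicalSpaceH k n d)

/-- The Euclidean topology on `Bir(ℙ^n_k)`: the inductive limit of the `Bir(ℙ^n_k)_{≤ d}`, `d ≥ 1`,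
that is, the finest topology for which all these inclusions are continuous. -/
instance instTopologicalSpaceBir : TopologicalSpace (Bir k n) :=
  ⨆ (d : ℕ) (_ : 1 ≤ d),
    TopologicalSpace.coinduced (BirLE.incl (d := d)) (instTopologicalSpaceBirLE k n d)

end Topology

section Family

variable (k : Type*) [RCLike k] (n : ℕ)

/-- The linear form `P^t = cos(2π/t) x_0 + x_1`. -/
def linForm (t : ℝ) : MvPolynomial (Fin (n + 1)) k :=
  C ((Real.cos (2 * Real.pi / t) : ℝ) : k) * X 0 + X 1

/-- The tuple `(x_0 P^t, x_1 P^t, x_2 P^t + t x_0 x_1, x_3 P^t, …, x_n P^t)` (for `n ≥ 2`). -/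
def familyTuple (t : ℝ) : HomTuple k n 2 := fun i =>
  ⟨X i * linForm k n t + if (i : ℕ) = 2 then C ((t : ℝ) : k) * (X 0 * X 1) else 0, by
    have hP : (linForm k n t).IsHomogeneous 1 :=
      (isHomogeneous_C_mul_X _ _).add (isHomogeneous_X k _)
    refine (mem_homogeneousSubmodule _ _).2 (((isHomogeneous_X k i).mul hP).add ?_)
    split_ifs
    · exact ((isHomogeneous_X k _).mul (isHomogeneous_X k _)).C_mul _
    · exact isHomogeneous_zero _ _ _⟩

theorem familyTuple_ne_zero {n : ℕ} (hn : 2 ≤ n) (t : ℝ) : familyTuple k n t ≠ 0 := by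
  intro h
  have h0 : (X 0 * linForm k n t + if ((0 : Fin (n + 1)) : ℕ) = 2 then
      C ((t : ℝ) : k) * (X 0 * X 1) else 0 : MvPolynomial (Fin (n + 1)) k) = 0 :=
    congrArg Subtype.val (congrFun h 0)
  have h1 : ((1 : Fin (n + 1)) : ℕ) = 1 := by
    rw [Fin.val_one', Nat.mod_eq_of_lt (by omega)]
  have h10 : (1 : Fin (n + 1)) ≠ 0 := fun h => by
    have := congrArg Fin.val h
    rw [h1] at this
    simp at this
  simp only [Fin.val_zero, OfNat.zero_ne_ofNat, if_false, add_zero] at h0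
  have hP := (mul_eq_zero.1 h0).resolve_left (X_ne_zero 0)
  have := congrArg (eval (fun i : Fin (n + 1) => if i = 1 then (1 : k) else 0)) hP
  simp [linForm, h10.symm] at this

/-- The family of rational maps of `ℙ^n`, `n ≥ 2`: the identity for `t = 0`, and
`[x_0 P^t : x_1 P^t : x_2 P^t + t x_0 x_1 : x_3 P^t : … : x_n P^t]` for `t ≠ 0`. -/
def family {n : ℕ} (hn : 2 ≤ n) (t : ℝ) : RatMap k n :=
  if t = 0 then RatMap.id k n else RatMap.of (familyTuple k n t) (familyTuple_ne_zero k hn t)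

end Family

end Cremona

end

noncomputable section

open MvPolynomial Filter Topology

namespace Cremona

/-! Decouple the oscillation from `t`: with `P = c x_0 + x_1` and `c`, `t` independent, `shear` is
continuous in `(c, t)`, and at `t = 0` its image in `Bir` is the identity for every `c`. As the
cosine stays in the compact interval `[-1, 1]`, the tube lemma makes the family continuous at `0`
(`continuous_comp_cos_two_pi_div`).

A lift `r` cannot cancel the factor `P`. For `t ≠ 0` the first component of `r t` vanishes wherever
`P = 0` and `x_0 x_1 ≠ 0` (`mem_vanishingSet_of_piMap_eq`). Each ratio in `(0, 1]` is a value of the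
cosine for parameters tending to `0`, so in the limit the first component of `r 0` vanishes on an
infinite grid and is zero. Since `r 0` represents the identity, the whole tuple is then zero, which
is impossible. -/

theorem RatMap.of_eq_of_iff {k : Type*} [Field k] {n d e : ℕ} {F : HomTuple k n d}
    {G : HomTuple k n e} {hF : F ≠ 0} {hG : G ≠ 0} :
    RatMap.of F hF = RatMap.of G hG ↔
      ∀ i j, (F i : MvPolynomial (Fin (n + 1)) k) * G j = F j * G i :=
  Quotient.eq (r := formulaSetoid k n)

/-- The point of `W_d(k)` represented by a nonzero tuple. -/
def W.mk {k : Type*} [Field k] {n d : ℕ} (F : {F : HomTuple k n d // F ≠ 0}) : W k n d :=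
  Projectivization.mk k F.1 F.2

theorem W.exists_eq_mk {k : Type*} [Field k] {n d : ℕ} (h : W k n d) : ∃ F, h = W.mk F :=
  ⟨⟨_, Projectivization.rep_nonzero h⟩, (Projectivization.mk_rep h).symm⟩

theorem H.piMap_eq_piMap_iff {k : Type*} [Field k] {n d e : ℕ} {h : H k n d} {h' : H k n e}
    {F : {F : HomTuple k n d // F ≠ 0}} {G : {G : HomTuple k n e // G ≠ 0}}
    (hF : h.1 = W.mk F) (hG : h'.1 = W.mk G) : piMap h = piMap h' ↔
      ∀ i j, (F.1 i : MvPolynomial (Fin (n + 1)) k) * G.1 j = F.1 j * G.1 i := by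
  rw [← RatMap.of_eq_of_iff (hF := F.2) (hG := G.2)]
  change _ ↔ (W.mk F).toRatMap = (W.mk G).toRatMap
  rw [← hF, ← hG]
  exact Subtype.ext_iff

theorem fin_val_one {n : ℕ} (hn : 2 ≤ n) : ((1 : Fin (n + 1)) : ℕ) = 1 := by
  rw [Fin.val_one', Nat.mod_eq_of_lt (by omega)]

/-! ### Birational shears with independent parameters -/

section Shear

variable {k : Type*} [Field k] {n : ℕ}

/-- The tuple `(x_0 P, x_1 P, x_2 P + t x_0 x_1, x_3 P, …, x_n P)` with `P = c x_0 + x_1`. -/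
def shearTuple (n : ℕ) (c t : k) : HomTuple k n 2 := fun i =>
  ⟨X i * (C c * X 0 + X 1) + if (i : ℕ) = 2 then C t * (X 0 * X 1) else 0, by
    have hP : (C c * X 0 + X 1 : MvPolynomial (Fin (n + 1)) k).IsHomogeneous 1 :=
      (isHomogeneous_C_mul_X _ _).add (isHomogeneous_X k _)
    refine (mem_homogeneousSubmodule _ _).2 (((isHomogeneous_X k i).mul hP).add ?_)
    split_ifs
    · exact ((isHomogeneous_X k _).mul (isHomogeneous_X k _)).C_mul _
    · exact isHomogeneous_zero _ _ _⟩

theorem coe_shearTuple (c t : k) (i : Fin (n + 1)) :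
    (shearTuple n c t i : MvPolynomial (Fin (n + 1)) k) =
      X i * (C c * X 0 + X 1) + if (i : ℕ) = 2 then C t * (X 0 * X 1) else 0 := rfl

theorem linearForm_ne_zero (hn : 2 ≤ n) (c : k) :
    (C c * X 0 + X 1 : MvPolynomial (Fin (n + 1)) k) ≠ 0 := by
  intro h
  have h10 : (0 : Fin (n + 1)) ≠ 1 := fun h => by
    have := congrArg Fin.val h
    rw [fin_val_one hn] at this
    simp at this
  have := congrArg (eval (fun i : Fin (n + 1) => if i = 1 then (1 : k) else 0)) h
  simp [h10] at this

theorem coe_shearTuple_zero (c t : k) :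
    (shearTuple n c t 0 : MvPolynomial (Fin (n + 1)) k) = X 0 * (C c * X 0 + X 1) := by
  simp [coe_shearTuple]

theorem coe_shearTuple_one (hn : 2 ≤ n) (c t : k) :
    (shearTuple n c t 1 : MvPolynomial (Fin (n + 1)) k) = X 1 * (C c * X 0 + X 1) := by
  rw [coe_shearTuple, if_neg (by rw [fin_val_one hn]; decide), add_zero]

theorem shearTuple_ne_zero (hn : 2 ≤ n) (c t : k) : shearTuple n c t ≠ 0 := fun h =>
  mul_ne_zero (X_ne_zero 0) (linearForm_ne_zero hn c)
    ((coe_shearTuple_zero c t).symm.trans (congrArg Subtype.val (congrFun h 0)))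

/-- The map fixes `[x_0 : x_1]` and adds `t x_0 x_1 / P` to `x_2`, so the parameters `t` and `-t`
cancel. Substitution turns `P` into `P ^ 2`, which accounts for the cube. -/
theorem coe_shearTuple_comp (hn : 2 ≤ n) (c t : k) (i : Fin (n + 1)) :
    ((shearTuple n c t).comp (shearTuple n c (-t)) i : MvPolynomial (Fin (n + 1)) k) =
      (C c * X 0 + X 1) ^ 3 * X i := by
  change bind₁ _ (shearTuple n c t i : MvPolynomial (Fin (n + 1)) k) = _
  rw [coe_shearTuple]
  have hC : ∀ a : k, bind₁ (fun j => (shearTuple n c (-t) j : MvPolynomial (Fin (n + 1)) k)) (C a)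
      = C a := fun a => bind₁_C_right _ _
  simp only [map_add, map_mul, bind₁_X_right, hC, coe_shearTuple_zero, coe_shearTuple_one hn]
  split_ifs with h
  · simp only [map_mul, bind₁_X_right, hC, coe_shearTuple_zero, coe_shearTuple_one hn]
    simp only [coe_shearTuple, if_pos h, C_neg]
    ring
  · simp only [coe_shearTuple, if_neg h, map_zero]
    ring

theorem isComp_shearTuple (hn : 2 ≤ n) (c t : k) :
    RatMap.IsComp (RatMap.of _ (shearTuple_ne_zero hn c t))
      (RatMap.of _ (shearTuple_ne_zero hn c (-t))) (RatMap.id k n) := by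
  refine ⟨2, 2, _, _, shearTuple_ne_zero hn c t, shearTuple_ne_zero hn c (-t), fun h => ?_, rfl,
    rfl, RatMap.of_eq_of_iff.2 fun i j => ?_⟩
  · exact mul_ne_zero (pow_ne_zero 3 (linearForm_ne_zero hn c)) (X_ne_zero 0)
      ((coe_shearTuple_comp hn c t 0).symm.trans (congrArg Subtype.val (congrFun h 0)))
  · rw [coe_shearTuple_comp hn, coe_shearTuple_comp hn]
    change _ * X j = _ * X i
    ring

theorem isBirational_shearTuple (hn : 2 ≤ n) (c t : k) :
    (RatMap.of _ (shearTuple_ne_zero hn c t)).IsBirational :=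
  ⟨_, isComp_shearTuple hn c t, by simpa using isComp_shearTuple hn c (-t)⟩

theorem of_shearTuple_zero (hn : 2 ≤ n) (c : k) :
    RatMap.of _ (shearTuple_ne_zero hn c 0) = RatMap.id k n := by
  refine RatMap.of_eq_of_iff.2 fun i j => ?_
  change _ * X j = _ * X i
  simp only [coe_shearTuple, C_0, zero_mul, ite_self]
  ring

/-- The point of `H_2(k)` given by `shearTuple`. -/
def shear (hn : 2 ≤ n) (c t : k) : H k n 2 :=
  ⟨W.mk ⟨shearTuple n c t, shearTuple_ne_zero hn c t⟩,
    isBirational_shearTuple hn c t⟩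

/-- At `t = 0` the common factor `P` still distinguishes the points of `H_2`; only their image in
`Bir` forgets `c`. -/
theorem piMap_shear_zero (hn : 2 ≤ n) (c c' : k) : piMap (shear hn c 0) = piMap (shear hn c' 0) :=
  Subtype.ext ((of_shearTuple_zero hn c).trans (of_shearTuple_zero hn c').symm)

end Shear

/-- The vanishing of the `i`-th component at `a`, as a set of points of `W_d(k)`. -/
def vanishingSet {k : Type*} [Field k] {n : ℕ} (d : ℕ) (i : Fin (n + 1)) (a : Fin (n + 1) → k) :
    Set (W k n d) :=
  {h | eval a (Projectivization.rep h i : MvPolynomial (Fin (n + 1)) k) = 0}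

theorem mk_mem_vanishingSet {k : Type*} [Field k] {n d : ℕ} (i : Fin (n + 1))
    (a : Fin (n + 1) → k) (F : {F : HomTuple k n d // F ≠ 0}) :
    W.mk F ∈ vanishingSet d i a ↔ eval a (F.1 i : MvPolynomial (Fin (n + 1)) k) = 0 := by
  obtain ⟨u, hu⟩ := Projectivization.exists_smul_eq_mk_rep k F.1 F.2
  change eval a ((Projectivization.mk k F.1 F.2).rep i : MvPolynomial (Fin (n + 1)) k) = 0 ↔ _
  rw [← hu]
  change eval a ((u : k) • (F.1 i : MvPolynomial (Fin (n + 1)) k)) = 0 ↔ _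
  rw [smul_eval, mul_eq_zero, or_iff_right u.ne_zero]

/-! ### Continuity of the shears and closedness of vanishing conditions -/

section Topology

variable {k : Type*} [Field k] [TopologicalSpace k] {n d : ℕ}

theorem continuous_piMap (hd : 1 ≤ d) : Continuous (piMap : H k n d → Bir k n) := by
  have h₁ : Continuous (piMapLE : H k n d → BirLE k n d) := continuous_coinduced_rng
  have h₂ : Continuous (BirLE.incl : BirLE k n d → Bir k n) :=
    continuous_iff_coinduced_le.2 (le_iSup₂_of_le (f := fun (d : ℕ) (_ : 1 ≤ d) =>
      TopologicalSpace.coinduced (BirLE.incl (k := k) (n := n) (d := d))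
        (instTopologicalSpaceBirLE k n d)) d hd le_rfl)
  exact h₂.comp h₁

theorem continuous_coeff (m : Fin (n + 1) →₀ ℕ) :
    Continuous fun p : homogeneousSubmodule (Fin (n + 1)) k d =>
      coeff m (p : MvPolynomial (Fin (n + 1)) k) :=
  (continuous_apply m).comp continuous_induced_dom

theorem continuous_homogeneous_iff {Y : Type*} [TopologicalSpace Y]
    {f : Y → homogeneousSubmodule (Fin (n + 1)) k d} :
    Continuous f ↔ ∀ m, Continuous fun y => coeff m (f y : MvPolynomial (Fin (n + 1)) k) :=
  continuous_induced_rng.trans continuous_pi_iff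

/-- Homogeneity confines all supports to the finite set of monomials of degree `d`, so evaluation is
one fixed finite sum of coefficients. -/
theorem continuous_eval [IsTopologicalSemiring k] (a : Fin (n + 1) → k) :
    Continuous fun p : homogeneousSubmodule (Fin (n + 1)) k d =>
      eval a (p : MvPolynomial (Fin (n + 1)) k) := by
  have hfin : {m : Fin (n + 1) →₀ ℕ | m.degree = d}.Finite :=
    Finsupp.finite_of_degree_le d |>.subset fun m hm => le_of_eq hm
  have : ∀ p : homogeneousSubmodule (Fin (n + 1)) k d,
      eval a (p : MvPolynomial (Fin (n + 1)) k) =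
        ∑ m ∈ hfin.toFinset, coeff m (p : MvPolynomial (Fin (n + 1)) k) * ∏ i, a i ^ m i := by
    intro p
    rw [eval_eq']
    refine Finset.sum_subset (fun m hm => ?_) fun m _ hm => ?_
    · rw [Set.Finite.mem_toFinset, Set.mem_ofPred_eq]
      by_contra h
      exact mem_support_iff.1 hm (((mem_homogeneousSubmodule _ _).1 p.2).coeff_eq_zero h)
    · rw [notMem_support_iff.1 hm, zero_mul]
  simp only [this]
  exact continuous_finsetSum _ fun m _ => (continuous_coeff m).mul continuous_const

theorem isClosed_vanishingSet [IsTopologicalSemiring k] [T1Space k] (i : Fin (n + 1))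
    (a : Fin (n + 1) → k) : IsClosed (vanishingSet d i a) := by
  refine isClosed_coinduced.2 ?_
  have : W.mk ⁻¹' vanishingSet d i a =
      (fun F => eval a (F.1 i : MvPolynomial (Fin (n + 1)) k)) ⁻¹' {0} :=
    Set.ext fun F => mk_mem_vanishingSet i a F
  change IsClosed (W.mk ⁻¹' vanishingSet d i a)
  rw [this]
  exact isClosed_singleton.preimage
    ((continuous_eval a).comp ((continuous_apply i).comp continuous_subtype_val))

theorem continuous_W_mk : Continuous (W.mk : {F : HomTuple k n d // F ≠ 0} → W k n d) :=
  continuous_coinduced_rng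

theorem continuous_shear [IsTopologicalSemiring k] (hn : 2 ≤ n) :
    Continuous fun q : k × k => shear hn q.1 q.2 := by
  refine continuous_induced_rng.2 ?_
  have h : Continuous fun q : k × k =>
      (⟨shearTuple n q.1 q.2, shearTuple_ne_zero hn q.1 q.2⟩ : {F : HomTuple k n 2 // F ≠ 0}) := by
    refine Continuous.subtype_mk (continuous_pi fun i => continuous_homogeneous_iff.2 fun m => ?_) _
    have : ∀ q : k × k, coeff m (shearTuple n q.1 q.2 i : MvPolynomial (Fin (n + 1)) k) =
        q.1 * coeff m (X i * X 0 : MvPolynomial (Fin (n + 1)) k) + coeff m (X i * X 1) +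
          if (i : ℕ) = 2 then q.2 * coeff m (X 0 * X 1 : MvPolynomial (Fin (n + 1)) k) else 0 := by
      intro q
      rw [coe_shearTuple, mul_add, mul_left_comm, coeff_add, coeff_add, coeff_C_mul]
      split_ifs
      · rw [coeff_C_mul]
      · rw [coeff_zero]
    simp only [this]
    split_ifs <;> fun_prop
  exact continuous_W_mk.comp h

theorem continuous_piMap_shear [IsTopologicalSemiring k] (hn : 2 ≤ n) :
    Continuous fun q : k × k => piMap (shear hn q.1 q.2) :=
  (continuous_piMap one_le_two).comp (continuous_shear hn)

end Topology

/-! ### Continuity of the oscillating family -/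

section Family

variable {k : Type*} [RCLike k] {n : ℕ}

/-- The parametrized family as a map to `Bir`. -/
def birFamily (k : Type*) [RCLike k] {n : ℕ} (hn : 2 ≤ n) (t : ℝ) : Bir k n :=
  piMap (shear hn ((Real.cos (2 * Real.pi / t) : ℝ) : k) (t : k))

theorem coe_birFamily (hn : 2 ≤ n) (t : ℝ) : (birFamily k hn t).1 = family k hn t := by
  unfold family
  split_ifs with h
  · subst h
    -- Here `2 * Real.pi / 0 = 0`, so `c = 1`; any value would do.
    have h0 := of_shearTuple_zero hn ((Real.cos (2 * Real.pi / 0) : ℝ) : k)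
    rw [birFamily, RCLike.ofReal_zero]
    exact h0
  · rfl

/-- Oscillation in a parameter that becomes irrelevant at `t = 0` does not affect continuity. -/
theorem continuous_comp_cos_two_pi_div {Y : Type*} [TopologicalSpace Y] {Φ : ℝ × ℝ → Y}
    (hΦ : Continuous Φ) (h0 : ∀ c c', Φ (c, 0) = Φ (c', 0)) :
    Continuous fun t : ℝ => Φ (Real.cos (2 * Real.pi / t), t) := by
  refine continuous_iff_continuousAt.2 fun t => ?_
  rcases eq_or_ne t 0 with rfl | ht
  · refine tendsto_def.2 fun U hU => ?_
    obtain ⟨V, hVU, hV, h0V⟩ := mem_nhds_iff.1 hU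
    -- Compactness of `[-1, 1]` yields one neighbourhood of `0` in `t` that serves all values of the
    -- cosine.
    have hsub : Set.Icc (-1 : ℝ) 1 ×ˢ {(0 : ℝ)} ⊆ Φ ⁻¹' V := by
      rintro ⟨c, s⟩ ⟨-, hs⟩
      obtain rfl : s = 0 := hs
      rw [Set.mem_preimage, h0 c]
      exact h0V
    obtain ⟨A, B, -, hB, hA, h0B, hAB⟩ :=
      generalized_tube_lemma isCompact_Icc isCompact_singleton (hV.preimage hΦ) hsub
    filter_upwards [hB.mem_nhds (h0B rfl)] with s hs
    exact hVU (hAB ⟨hA ⟨Real.neg_one_le_cos _, Real.cos_le_one _⟩, hs⟩)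
  · have hcos : ContinuousAt (fun s : ℝ => (Real.cos (2 * Real.pi / s), s)) t :=
      (Real.continuous_cos.continuousAt.comp
        (continuousAt_const.div continuousAt_id ht)).prodMk continuousAt_id
    exact ContinuousAt.comp (f := fun s : ℝ => (Real.cos (2 * Real.pi / s), s))
      hΦ.continuousAt hcos

theorem continuous_birFamily (hn : 2 ≤ n) : Continuous (birFamily k hn) := by
  have hcast : Continuous fun q : ℝ × ℝ => ((q.1 : k), (q.2 : k)) :=
    (RCLike.continuous_ofReal.comp continuous_fst).prodMk
      (RCLike.continuous_ofReal.comp continuous_snd)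
  have hpi : Continuous fun q : k × k => piMap (shear hn q.1 q.2) := continuous_piMap_shear hn
  refine continuous_comp_cos_two_pi_div (hpi.comp hcast) fun c c' => ?_
  change piMap (shear hn (c : k) ((0 : ℝ) : k)) = piMap (shear hn (c' : k) ((0 : ℝ) : k))
  rw [RCLike.ofReal_zero]
  exact piMap_shear_zero hn _ _

/-! ### Absence of local lifts -/

/-- At `a`, where `P` vanishes, the minor of indices `0` and `2` reads `h_0(a) * (t a_0 a_1) = 0`.
-/
theorem mem_vanishingSet_of_piMap_eq {d : ℕ} (hn : 2 ≤ n) {h : H k n d} {c t : k}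
    (hh : piMap h = piMap (shear hn c t)) {a : Fin (n + 1) → k} (ht : t ≠ 0) (h0 : a 0 ≠ 0)
    (h1 : a 1 ≠ 0) (ha : c * a 0 + a 1 = 0) : h.1 ∈ vanishingSet d 0 a := by
  obtain ⟨F, hF⟩ := h.1.exists_eq_mk
  rw [hF, mk_mem_vanishingSet]
  have := congrArg (eval a) ((H.piMap_eq_piMap_iff hF rfl).1 hh 0 ⟨2, by omega⟩)
  simp only [coe_shearTuple, map_mul, map_add, eval_X, eval_C, ha, if_true, mul_zero, zero_add,
    Fin.val_zero, OfNat.zero_ne_ofNat, if_false, map_zero] at this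
  simpa [ht, h0, h1] using this

/-- A polynomial vanishing on a product of infinite sets is zero. Once `h_0 = 0`, proportionality to
`(x_0, …, x_n)` kills every component. -/
theorem not_forall_mem_vanishingSet {d : ℕ} (hn : 2 ≤ n) {h : H k n d} {c : k}
    (hh : piMap h = piMap (shear hn c 0)) {S : Fin (n + 1) → Set k} (hS : ∀ i, (S i).Infinite) :
    ¬ ∀ a ∈ Set.univ.pi S, h.1 ∈ vanishingSet d 0 a := by
  intro hv
  obtain ⟨F, hF⟩ := h.1.exists_eq_mk
  have h0 : (F.1 0 : MvPolynomial (Fin (n + 1)) k) = 0 :=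
    funext_set S hS fun a ha => by
      rw [map_zero]
      exact (mk_mem_vanishingSet 0 a F).1 (hF ▸ hv a ha)
  refine F.2 (funext fun i => Subtype.ext ?_)
  have hrel := (H.piMap_eq_piMap_iff hF rfl).1 hh i 0
  rw [coe_shearTuple_zero, h0, zero_mul] at hrel
  exact (mul_eq_zero.1 hrel).resolve_right (mul_ne_zero (X_ne_zero 0) (linearForm_ne_zero hn c))

theorem tendsto_two_pi_div_add (θ : ℝ) :
    Tendsto (fun m : ℕ => 2 * Real.pi / (θ + m * (2 * Real.pi))) atTop (𝓝 0) :=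
  Tendsto.const_div_atTop (tendsto_atTop_add_const_left _ _
    (tendsto_natCast_atTop_atTop.atTop_mul_const Real.two_pi_pos)) _

/-- The parameters `s m` tend to `0` and have cosine `y / x`, so that `P` vanishes at `a` for each
of them; the vanishing set is closed. -/
theorem mem_vanishingSet_zero_of_lift {d : ℕ} (hn : 2 ≤ n) {ε : ℝ} (hε : 0 < ε)
    {r : Set.Ioo (-ε) ε → H k n d} (hr : Continuous r)
    (hlift : ∀ t : Set.Ioo (-ε) ε, birFamily k hn t = piMap (r t)) {x y : ℝ} (hx : 0 < x) (hy : 0 < y)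
    (hyx : y ≤ x) {a : Fin (n + 1) → k} (h0 : a 0 = x) (h1 : a 1 = ((-y : ℝ) : k)) :
    (r ⟨0, neg_lt_zero.2 hε, hε⟩).1 ∈ vanishingSet d 0 a := by
  set θ := Real.arccos (y / x)
  set s : ℕ → ℝ := fun m => 2 * Real.pi / (θ + m * (2 * Real.pi))
  have hs : Tendsto s atTop (𝓝 0) := tendsto_two_pi_div_add θ
  have hclosed : IsClosed {t | (r t).1 ∈ vanishingSet d 0 a} :=
    (isClosed_vanishingSet 0 a).preimage (continuous_induced_dom.comp hr)
  have hmem : ∀ᶠ m in atTop, s m ∈ Set.Ioo (-ε) ε :=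
    hs.eventually (Ioo_mem_nhds (neg_lt_zero.2 hε) hε)
  have hclosure : (⟨0, neg_lt_zero.2 hε, hε⟩ : Set.Ioo (-ε) ε) ∈
      closure {t | (r t).1 ∈ vanishingSet d 0 a} := by
    rw [closure_subtype]
    refine mem_closure_of_tendsto hs ?_
    -- If `y = x` then `θ = 0`, and `m = 0` would give a zero denominator.
    filter_upwards [hmem, eventually_ge_atTop 1] with m hm hm1
    refine ⟨⟨s m, hm⟩, ?_, rfl⟩
    have hden : 0 < θ + m * (2 * Real.pi) :=
      add_pos_of_nonneg_of_pos (Real.arccos_nonneg _)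
        (mul_pos (Nat.cast_pos.2 hm1) Real.two_pi_pos)
    have hcos : Real.cos (2 * Real.pi / s m) = y / x := by
      rw [div_div_cancel₀ Real.two_pi_pos.ne', Real.cos_add_nat_mul_two_pi]
      exact Real.cos_arccos (by have := div_pos hy hx; linarith) ((div_le_one hx).2 hyx)
    refine mem_vanishingSet_of_piMap_eq hn (hlift ⟨s m, hm⟩).symm
      (RCLike.ofReal_ne_zero.2 (div_pos Real.two_pi_pos hden).ne') ?_ ?_ ?_
    · rw [h0]
      exact RCLike.ofReal_ne_zero.2 hx.ne'
    · rw [h1]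
      exact RCLike.ofReal_ne_zero.2 (neg_ne_zero.2 hy.ne')
    · rw [h0, h1]
      change ((Real.cos (2 * Real.pi / s m) : ℝ) : k) * x + ((-y : ℝ) : k) = 0
      rw [hcos, ← RCLike.ofReal_mul, ← RCLike.ofReal_add, div_mul_cancel₀ _ hx.ne', add_neg_cancel,
        RCLike.ofReal_zero]
  rwa [hclosed.closure_eq] at hclosure

theorem not_exists_lift {d : ℕ} (hn : 2 ≤ n) {ε : ℝ} (hε : 0 < ε)
    {r : Set.Ioo (-ε) ε → H k n d} (hr : Continuous r) :
    ¬ ∀ t : Set.Ioo (-ε) ε, birFamily k hn t = piMap (r t) := by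
  intro hlift
  have h01 : (1 : Fin (n + 1)) ≠ 0 := fun h => by
    have := congrArg Fin.val h
    rw [fin_val_one hn] at this
    simp at this
  have hzero := (hlift ⟨0, neg_lt_zero.2 hε, hε⟩).symm
  simp only [birFamily, RCLike.ofReal_zero] at hzero
  -- The intervals ensure `0 < y < x`. Real points suffice over both fields, and the coordinates
  -- other than `0` and `1` are unconstrained.
  refine not_forall_mem_vanishingSet hn hzero
    (S := fun i => if i = 1 then (fun y : ℝ => ((-y : ℝ) : k)) '' Set.Ioo 0 1
      else (fun x : ℝ => (x : k)) '' Set.Ioo 1 2) (fun i => ?_) fun a ha => ?_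
  · split_ifs
    · exact (Set.Ioo_infinite one_pos).image
        (RCLike.ofReal_injective.comp neg_injective).injOn
    · exact (Set.Ioo_infinite one_lt_two).image RCLike.ofReal_injective.injOn
  · have ha0 := ha 0 trivial
    have ha1 := ha 1 trivial
    simp only [if_neg h01.symm, if_true] at ha0 ha1
    obtain ⟨x, hx, hx0⟩ := ha0
    obtain ⟨y, hy, hy1⟩ := ha1
    exact mem_vanishingSet_zero_of_lift hn hε hr hlift (one_pos.trans hx.1) hy.1
      (hy.2.trans hx.1).le hx0.symm hy1.symm

end Family

end Cremona

end

theorem proposition4 {k : Type*} [RCLike k] (n : ℕ) (hn : 2 ≤ n) :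
    ∃ ρ : Set.Icc (-1 : ℝ) 1 → Cremona.Bir k n,
      (∀ t, (ρ t).1 = Cremona.family k hn t) ∧
      Continuous ρ ∧
      ∀ (ε : ℝ) (_ : 0 < ε) (hε : ε ≤ 1) (d : ℕ), 1 ≤ d →
        ¬ ∃ ρε : Set.Ioo (-ε) ε → Cremona.H k n d,
          Continuous ρε ∧
          ∀ t : Set.Ioo (-ε) ε,
            ρ ⟨t, (neg_le_neg hε).trans t.2.1.le, t.2.2.le.trans hε⟩ = Cremona.piMap (ρε t) :=
  ⟨fun t => Cremona.birFamily k hn t, fun t => Cremona.coe_birFamily hn t,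
    (Cremona.continuous_birFamily hn).comp continuous_subtype_val,
    fun _ hε _ _ _ ⟨_, hr, hlift⟩ => Cremona.not_exists_lift hn hε hr hlift⟩
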